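/- Let $r,\rho\in(0,\infty)$ with $r<1<\rho$ be such that for all integers $k,\ell$ one has $r^k=\rho^\ell$ only if $k=\ell=0$. Let $\mathbb X=([0,1]\cup[2,3]\cup[4,5]\cup\cdots)\cup\{\infty\}$ be the one-point compactification of the subspace $Y=[0,1]\cup[2,3]\cup[4,5]\cup\cdots$ of $\mathbb R$, and let $$H=\{(t,rt): t\in[0,1]\}\cup\{(t,\rho t): t,\rho t\in[0,1]\}\cup\{(t,t+2): t\in Y\}\cup\{(t,t-2): t\in Y,\ t\ge 2\}\cup\{(t,t): t\in Y\}\cup\{(\infty,\infty)\}\subseteq\mathbb X\times\mathbb X.$$ Let $\mathbb X_H^+$ be the space of sequences $(x_1,x_2,\ldots)$ in $\mathbb X$ with $(x_i,x_{i+1})\in H$ for all $i\ge 1$, and let $\mathbb X_H$ be the space of two-sided sequences $(x_i)_{i\in\mathbb Z}$ in $\mathbb X$ with $(x_i,x_{i+1})\in H$ for all $i\in\mathbb Z$, both with the subspace topology of the product topology; let $\sigma_H^+$ and $\sigma_H$ be the shift maps $(x_i)\mapsto(x_{i+1})$ on them. For a set $S\subseteq\mathbb X$, let $\sim_1$ on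 $\mathbb X_H^+$ and $\sim_2$ on $\mathbb X_H$ be the equivalence relations $$\mathbf x\sim\mathbf y\iff \mathbf x=\mathbf y\ \text{ or }\ x_k,y_k\in S\text{ for all }k,$$ give $\mathbb X_H^+/_{\sim_1}$ and $\mathbb X_H/_{\sim_2}$ the quotient topology, and let $(\sigma_H^+)^\star([\mathbf x])=[\sigma_H^+(\mathbf x)]$ and $\sigma_H^\star([\mathbf x])=[\sigma_H(\mathbf x)]$ be the induced (well-defined) maps. A self-map $f$ of a topological space is topologically mixing if for all non-empty open sets $U,V$ there is $n_0$ with $f^n(U)\cap V\neq\emptyset$ for all positive integers $n\ge n_0$. A dynamical system is a compact metrizable space with a continuous self-map. Let $S=\{0,2,4,6,\ldots\}\cup\{\infty\}$. Then: 1. $(\mathbb X_H^+/_{\sim_1},(\sigma_H^+)^\star)$ is a dynamical system, $(\sigma_H^+)^\star$ is non-invertible (not a bijection), and it is topologically mixing. 2. $(\mathbb X_H/_{\sim_2},\sigma_H^\star)$ is a dynamical system, $\sigma_H^\star$ is a homeomorphism, and it is topologically mixing. If instead $S=\{0,2,4,6,\ldots\}$, then $(\sigma_H^+)^\star$ is a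 continuous, non-invertible and topologically mixing map of $\mathbb X_H^+/_{\sim_1}$, and $\sigma_H^\star$ is a topologically mixing homeomorphism of $\mathbb X_H/_{\sim_2}$. -/

import Mathlib

namespace LelekMixing

/-! General notions: mixing, Mahavier products, shifts, and quotients gluing constrained points. -/

section General

/-- `f` is topologically mixing: for all non-empty open `U`, `V` there is `n₀` such that
`fⁿ(U) ∩ V ≠ ∅` for all positive integers `n ≥ n₀`. -/
def TopologicallyMixing {X : Type*} [TopologicalSpace X] (f : X → X) : Prop :=
  ∀ U V : Set X, IsOpen U → IsOpen V → U.Nonempty → V.Nonempty →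
    ∃ n₀ : ℕ, ∀ n : ℕ, 0 < n → n₀ ≤ n → (f^[n] '' U ∩ V).Nonempty

/-- `(X, f)` is a dynamical system: `X` is a compact metrizable space, `f` is continuous. -/
structure IsDynamicalSystem {X : Type*} [TopologicalSpace X] (f : X → X) : Prop where
  compact : CompactSpace X
  metrizable : TopologicalSpace.MetrizableSpace X
  continuous : Continuous f

variable {X : Type*}

/-- The Mahavier product of a relation `F`; the first coordinate has index `0`.
It carries the subspace topology of the product topology. -/
abbrev MahavierPlus (F : Set (X × X)) : Type _ :=
  {x : ℕ → X // ∀ i : ℕ, (x i, x (i + 1)) ∈ F}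

/-- The two-sided Mahavier product of a relation `F`. -/
abbrev MahavierTwo (F : Set (X × X)) : Type _ :=
  {x : ℤ → X // ∀ i : ℤ, (x i, x (i + 1)) ∈ F}

/-- The shift map on the Mahavier product. -/
def shiftPlus (F : Set (X × X)) (x : MahavierPlus F) : MahavierPlus F :=
  ⟨fun i => x.1 (i + 1), fun i => x.2 (i + 1)⟩

/-- The shift map on the two-sided Mahavier product. -/
def shiftTwo (F : Set (X × X)) (x : MahavierTwo F) : MahavierTwo F :=
  ⟨fun i => x.1 (i + 1), fun i => x.2 (i + 1)⟩

/-- For a set `S ⊆ X` and a set `P` of families of points of `X`, the equivalence relation on `P`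
that glues all families with every coordinate in `S` to one point:
`x ∼ y` iff `x = y` or all coordinates of `x` and of `y` lie in `S`. -/
def glue {ι : Type*} (S : Set X) (P : (ι → X) → Prop) : Setoid {x : ι → X // P x} where
  r x y := x = y ∨ ∀ k, x.1 k ∈ S ∧ y.1 k ∈ S
  iseqv :=
    { refl := fun _ => Or.inl rfl
      symm := by
        rintro x y (h | h)
        · exact Or.inl h.symm
        · exact Or.inr fun k => ⟨(h k).2, (h k).1⟩
      trans := by
        rintro x y z (rfl | h) (rfl | h')
        · exact Or.inl rfl
        · exact Or.inr h'
        · exact Or.inr h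
        · exact Or.inr fun k => ⟨(h k).1, (h' k).2⟩ }

/-- The relation `∼₁` on the Mahavier product, gluing along `S`. -/
abbrev simPlus (F : Set (X × X)) (S : Set X) : Setoid (MahavierPlus F) :=
  glue S fun x : ℕ → X => ∀ i : ℕ, (x i, x (i + 1)) ∈ F

/-- The relation `∼₂` on the two-sided Mahavier product, gluing along `S`. -/
abbrev simTwo (F : Set (X × X)) (S : Set X) : Setoid (MahavierTwo F) :=
  glue S fun x : ℤ → X => ∀ i : ℤ, (x i, x (i + 1)) ∈ F

/-- The map `[x] ↦ [σ⁺(x)]` induced by the shift on the quotient of the Mahavier product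
(which has the quotient topology). -/
def shiftPlusStar (F : Set (X × X)) (S : Set X) :
    Quotient (simPlus F S) → Quotient (simPlus F S) :=
  Quotient.map (shiftPlus F) (by
    rintro x y (rfl | h)
    · exact Or.inl rfl
    · exact Or.inr fun k => h (k + 1))

/-- The map `[x] ↦ [σ(x)]` induced by the shift on the quotient of the two-sided Mahavier
product (which has the quotient topology). -/
def shiftTwoStar (F : Set (X × X)) (S : Set X) :
    Quotient (simTwo F S) → Quotient (simTwo F S) :=
  Quotient.map (shiftTwo F) (by
    rintro x y (rfl | h)
    · exact Or.inl rfl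
    · exact Or.inr fun k => h (k + 1))

end General

/-! The space `𝕏` and the relation `H`. -/

/-- The subspace `[0,1] ∪ [2,3] ∪ [4,5] ∪ ⋯` of the real line. -/
abbrev Base : Type := {t : ℝ // ∃ k : ℕ, t ∈ Set.Icc (2 * k : ℝ) (2 * k + 1)}

/-- The one-point compactification `([0,1] ∪ [2,3] ∪ [4,5] ∪ ⋯) ∪ {∞}`. -/
abbrev XX : Type := OnePoint Base

/-- `r` and `ρ` never connect. -/
structure NeverConnect (r ρ : ℝ) : Prop where
  pos_left : 0 < r
  pos_right : 0 < ρ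
  left_lt_one : r < 1
  one_lt_right : 1 < ρ
  zpow_eq_iff : ∀ k l : ℤ, r ^ k = ρ ^ l ↔ k = 0 ∧ l = 0

/-- The pairs `(t, c t)` of the relation with `t` and `c t` both in `I₁ = [0,1]`. -/
def lineRel (c : ℝ) : Set (XX × XX) :=
  {p | ∃ s t : Base, s.1 ∈ Set.Icc (0 : ℝ) 1 ∧ t.1 ∈ Set.Icc (0 : ℝ) 1 ∧ t.1 = c * s.1 ∧
    p = ((s : XX), (t : XX))}

/-- The relation `H` on `𝕏`: the lines of slope `r` and `ρ` in `[0,1] × [0,1]`, the pairs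
`(t, t + 2)`, the pairs `(t, t - 2)` for `t ≥ 2`, the pairs `(t, t)`, and `(∞, ∞)`. -/
def H (r ρ : ℝ) : Set (XX × XX) :=
  lineRel r ∪ lineRel ρ ∪
  {p | ∃ s t : Base, t.1 = s.1 + 2 ∧ p = ((s : XX), (t : XX))} ∪
  {p | ∃ s t : Base, 2 ≤ s.1 ∧ t.1 = s.1 - 2 ∧ p = ((s : XX), (t : XX))} ∪
  {p | ∃ s : Base, p = ((s : XX), (s : XX))} ∪
  {(OnePoint.infty, OnePoint.infty)}

/-- The points `0, 2, 4, 6, …` of `𝕏`. -/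
def evenPts : Set XX := {p | ∃ s : Base, (∃ i : ℕ, s.1 = 2 * i) ∧ p = (s : XX)}

/-- The points `0, 2, 4, 6, …, ∞` of `𝕏`, i.e. the closure of the set of even points. -/
def evenPtsInfty : Set XX := evenPts ∪ {OnePoint.infty}

end LelekMixing

open LelekMixing

/-!
Every assertion about the quotients comes down to the Mahavier products themselves.

*Mixing.* A factor of a mixing map is mixing (`TopologicallyMixing.of_semiconj`), so it suffices
that the shift on the Mahavier product of `H` is mixing. Write the points of `𝕏` other than `∞` as
`pt k s = 2 k + s`, with level `k` and height `s ∈ [0, 1]`. Along `H` one may change the level by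
one, stay put, or, on level `0`, multiply the height by `r` or by `ρ`. In every open set there is a
sequence all of whose heights are positive (`exists_pos_height_mem`), and all heights of a sequence
may be scaled by a common factor in `[0, 1]` (`exists_scaled_mem`). As `log r / log ρ` is
irrational, the products `r ^ a * ρ ^ b` with `a b : ℕ` are dense in `(0, ∞)`
(`NeverConnect.exists_pow_mul_pow_mem_Ioo`). Hence from any point of positive height one can descend
to level `0`, contract and then expand the height to slightly below the height at which a prescribed
sequence starts, climb to its level, and continue along the scaled copy of that sequence. Since `H`
contains the diagonal, one can idle on the way, so every large length of the detour is possible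
(`topologicallyMixing_shiftPlus`). For the same reason one-sided sequences extend to the left by
constants, and the two-sided shift is mixing too (`TopologicallyMixing.shiftTwo_of_shiftPlus`).

*Dynamical systems.* The map `t ↦ 1 / (t + 1)`, `∞ ↦ 0` embeds `𝕏` in the line, and in this
coordinate `H` is cut out by polynomial equations and inequalities, hence closed. So the Mahavier
products are compact and metrizable. Collapsing a closed set `A` of a compact metric space yields a
metrizable space, because the functions `d(x, A)` and `d(x, A) d(x, qₙ)`, with `(qₙ)` dense, descend
to the quotient and separate its points (`metrizableSpace_quotient_of_collapse`).

*Invertibility.* The two-sided shift has a continuous inverse, which respects the gluing. The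
sequences `1, 1, 1, …` and `3, 1, 1, …` have the same one-sided shift but are not glued.
-/

open Set Filter Topology

namespace LelekMixing

/-! ### Factors of mixing maps -/

theorem TopologicallyMixing.of_semiconj {X Y : Type*} [TopologicalSpace X] [TopologicalSpace Y]
    {f : X → X} {g : Y → Y} {π : X → Y} (hf : TopologicallyMixing f) (hπ : Continuous π)
    (hsurj : Function.Surjective π) (hconj : Function.Semiconj π f g) :
    TopologicallyMixing g := by
  intro U V hU hV hUne hVne
  obtain ⟨N, hN⟩ := hf _ _ (hU.preimage hπ) (hV.preimage hπ)
    (hUne.preimage hsurj) (hVne.preimage hsurj)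
  refine ⟨N, fun n hn0 hn => ?_⟩
  obtain ⟨_, ⟨x, hx, rfl⟩, hy⟩ := hN n hn0 hn
  refine ⟨_, ⟨π x, hx, rfl⟩, ?_⟩
  rw [← (hconj.iterate_right n).eq]
  exact hy

/-! ### Density of the products of powers -/

/-- The combinations of `α < 0 < β` with natural coefficients are dense in `ℝ` if `α / β` is
irrational: the multiples `n • α` with `n : ℕ` accumulate at every point of the circle `ℝ ⧸ ℤβ`, and
for large `n` the multiple of `β` that returns `n * α` to the interval is positive. -/
theorem exists_nat_combination_mem_Ioo {α β x y : ℝ} (hα : α < 0) (hβ : 0 < β)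
    (hirr : Irrational (α / β)) (hxy : x < y) :
    ∃ a b : ℕ, a * α + b * β ∈ Ioo x y := by
  have : Fact (0 < β) := ⟨hβ⟩
  obtain ⟨w, hw⟩ := exists_between hxy
  have hcl : MapClusterPt (w : AddCircle β) atTop (fun n : ℕ => n • (α : AddCircle β)) := by
    rw [mapClusterPt_atTop_nsmul_iff_mem_topologicalClosure_zmultiples]
    exact AddCircle.denseRange_zsmul_coe_iff.2 hirr _
  have hnhds : ((↑) : ℝ → AddCircle β) '' Ioo x y ∈ 𝓝 (w : AddCircle β) :=
    (QuotientAddGroup.isOpenMap_coe _ isOpen_Ioo).mem_nhds ⟨w, hw, rfl⟩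
  have hev : ∀ᶠ n : ℕ in atTop, n * α < x :=
    (tendsto_natCast_atTop_atTop.atTop_mul_const_of_neg hα).eventually_lt_atBot x
  obtain ⟨n, ⟨z, hz, hzn⟩, hn⟩ := ((hcl.frequently hnhds).and_eventually hev).exists
  rw [← AddCircle.coe_nsmul, ← sub_eq_zero, ← AddCircle.coe_sub, AddCircle.coe_eq_zero_iff] at hzn
  obtain ⟨k, hk⟩ := hzn
  rw [zsmul_eq_mul, nsmul_eq_mul] at hk
  have hk0 : 0 ≤ k := by
    by_contra! hneg
    have : (k : ℝ) * β < 0 := mul_neg_of_neg_of_pos (by exact_mod_cast hneg) hβ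
    linarith [hz.1]
  lift k to ℕ using hk0
  refine ⟨n, k, ?_⟩
  have : (n : ℝ) * α + k * β = z := by push_cast at hk; linarith
  rwa [this]

theorem NeverConnect.irrational {r ρ : ℝ} (h : NeverConnect r ρ) :
    Irrational (Real.log r / Real.log ρ) := by
  rintro ⟨q, hq⟩
  have hρ := Real.log_pos h.one_lt_right
  have h1 : (q.den : ℝ) * Real.log r = q.num * Real.log ρ := by
    rw [eq_div_iff hρ.ne', Rat.cast_def] at hq
    have := q.den_pos
    field_simp at hq
    linarith
  have h2 : r ^ (q.den : ℤ) = ρ ^ q.num := by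
    apply Real.log_injOn_pos (zpow_pos h.pos_left _) (zpow_pos h.pos_right _)
    rw [Real.log_zpow, Real.log_zpow]
    exact_mod_cast h1
  have := ((h.zpow_eq_iff _ _).1 h2).1
  exact q.den_nz (by exact_mod_cast this)

theorem NeverConnect.exists_pow_mul_pow_mem_Ioo {r ρ x y : ℝ} (h : NeverConnect r ρ)
    (hx : 0 < x) (hxy : x < y) : ∃ a b : ℕ, r ^ a * ρ ^ b ∈ Ioo x y := by
  obtain ⟨a, b, h1, h2⟩ := exists_nat_combination_mem_Ioo
    (Real.log_neg h.pos_left h.left_lt_one) (Real.log_pos h.one_lt_right) h.irrational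
    (Real.log_lt_log hx hxy)
  have hr := h.pos_left
  have hρ := h.pos_right
  have hlog : Real.log (r ^ a * ρ ^ b) = a * Real.log r + b * Real.log ρ := by
    rw [Real.log_mul (by positivity) (by positivity), Real.log_pow, Real.log_pow]
  rw [← hlog] at h1 h2
  exact ⟨a, b, (Real.log_lt_log_iff hx (by positivity)).1 h1,
    (Real.log_lt_log_iff (by positivity) (hx.trans hxy)).1 h2⟩

/-! ### Quotients of Mahavier products -/

section Quotient

/-- Collapsing a non-empty closed subset `A` of a compact metrizable space to a point gives a
metrizable space. -/
theorem metrizableSpace_quotient_of_collapse {Z : Type*} [TopologicalSpace Z] [CompactSpace Z]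
    [TopologicalSpace.MetrizableSpace Z] (s : Setoid Z) {A : Set Z} (hA : IsClosed A)
    (hne : A.Nonempty) (hs : ∀ x y, s x y ↔ x = y ∨ (x ∈ A ∧ y ∈ A)) :
    TopologicalSpace.MetrizableSpace (Quotient s) := by
  let := TopologicalSpace.metrizableSpaceMetric Z
  have : Nonempty Z := hne.nonempty
  let q := TopologicalSpace.denseSeq Z
  -- The functions `infDist · A` and `infDist · A * dist · (q n)` vanish on `A`, hence descend.
  let F : Option ℕ → Z → ℝ := fun i x =>
    i.elim (Metric.infDist x A) fun n => Metric.infDist x A * dist x (q n)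
  have hFc : ∀ i, Continuous (F i) := by
    rintro (_ | n)
    · exact Metric.continuous_infDist_pt A
    · exact (Metric.continuous_infDist_pt A).mul (continuous_id.dist continuous_const)
  have hF0 : ∀ i, ∀ x ∈ A, F i x = 0 := by
    rintro (_ | n) x hx <;> simp [F, Metric.infDist_zero_of_mem hx]
  have hFr : ∀ i x y, s x y → F i x = F i y := by
    intro i x y hxy
    rcases (hs x y).1 hxy with rfl | ⟨hx, hy⟩
    · rfl
    · rw [hF0 i x hx, hF0 i y hy]
  have hΦ : Continuous fun (a : Quotient s) (i : Option ℕ) => Quotient.lift (F i) (hFr i) a :=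
    continuous_pi fun i => (hFc i).quotient_lift _
  refine (hΦ.isClosedEmbedding fun a b hab => ?_).isEmbedding.metrizableSpace
  induction a, b using Quotient.inductionOn₂ with | _ x y
  have hall : ∀ i, F i x = F i y := congrFun hab
  have h0 : Metric.infDist x A = Metric.infDist y A := hall none
  apply Quotient.sound
  apply (hs _ _).2
  rcases eq_or_ne (Metric.infDist y A) 0 with hd | hd
  · right
    rw [hA.mem_iff_infDist_zero hne, hA.mem_iff_infDist_zero hne]
    exact ⟨h0.trans hd, hd⟩
  · left
    have hd' : ∀ z, dist x z = dist y z := by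
      have : (fun z => dist x z) = fun z => dist y z := by
        refine DenseRange.equalizer (TopologicalSpace.denseRange_denseSeq Z)
          (by fun_prop) (by fun_prop) (funext fun n => ?_)
        have := hall (some n)
        simp only [F, Option.elim, h0] at this
        exact mul_left_cancel₀ hd this
      exact fun z => congrFun this z
    have := hd' y
    rw [dist_self, dist_eq_zero] at this
    exact this

variable {X : Type*} [TopologicalSpace X] (F : Set (X × X)) (S : Set X)

omit F S in
theorem continuous_coordinate {ι : Type*} (P : (ι → X) → Prop) (i : ι) :
    Continuous fun x : {x // P x} => x.1 i :=
  (continuous_apply i).comp continuous_subtype_val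

theorem continuous_shiftPlus : Continuous (shiftPlus F) :=
  (continuous_pi fun i => continuous_coordinate _ (i + 1)).subtype_mk _

theorem continuous_shiftTwo : Continuous (shiftTwo F) :=
  (continuous_pi fun i => continuous_coordinate _ (i + 1)).subtype_mk _

theorem continuous_shiftPlusStar : Continuous (shiftPlusStar F S) :=
  (continuous_shiftPlus F).quotient_map' _

theorem continuous_shiftTwoStar : Continuous (shiftTwoStar F S) :=
  (continuous_shiftTwo F).quotient_map' _

/-- The inverse of the two-sided shift. -/
def unshiftTwo (x : MahavierTwo F) : MahavierTwo F :=
  ⟨fun i => x.1 (i - 1), fun i => by simpa [sub_add_eq_add_sub] using x.2 (i - 1)⟩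

theorem isHomeomorph_shiftTwoStar : IsHomeomorph (shiftTwoStar F S) := by
  refine isHomeomorph_iff_exists_inverse.2 ⟨continuous_shiftTwoStar F S,
    Quotient.map (unshiftTwo F) ?_, ?_, ?_, ?_⟩
  · rintro x y (rfl | h)
    · exact Or.inl rfl
    · exact Or.inr fun k => h (k - 1)
  · intro a
    induction a using Quotient.inductionOn with | _ x
    exact congrArg (Quotient.mk _) (Subtype.ext (funext fun i => by simp [unshiftTwo, shiftTwo]))
  · intro a
    induction a using Quotient.inductionOn with | _ x
    exact congrArg (Quotient.mk _) (Subtype.ext (funext fun i => by simp [unshiftTwo, shiftTwo]))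
  · exact Continuous.quotient_map'
      ((continuous_pi fun i => continuous_coordinate _ (i - 1)).subtype_mk _) _

theorem compactSpace_constrained [CompactSpace X] {ι : Type*} (next : ι → ι) (hF : IsClosed F) :
    CompactSpace {x : ι → X // ∀ i, (x i, x (next i)) ∈ F} := by
  refine isCompact_iff_compactSpace.1 (IsClosed.isCompact (s := {x : ι → X | _}) ?_)
  simp only [ofPred_forall]
  exact isClosed_iInter fun i =>
    hF.preimage ((continuous_apply i).prodMk (continuous_apply (next i)))

variable {F S} in
/-- The point `c` makes the glued set non-empty, through the constant family at `c`. -/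
theorem metrizableSpace_glue [CompactSpace X] [TopologicalSpace.MetrizableSpace X]
    {ι : Type*} [Countable ι] (P : (ι → X) → Prop) [CompactSpace {x // P x}]
    (hS : IsClosed S) {c : X} (hc : c ∈ S) (hP : P fun _ => c) :
    TopologicalSpace.MetrizableSpace (Quotient (glue S P)) := by
  have : TopologicalSpace.MetrizableSpace {x // P x} := IsEmbedding.subtypeVal.metrizableSpace
  refine metrizableSpace_quotient_of_collapse (glue S P) (A := {x | ∀ k, x.1 k ∈ S}) ?_
    ⟨⟨fun _ => c, hP⟩, fun _ => hc⟩ fun x y => ?_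
  · simp only [ofPred_forall]
    exact isClosed_iInter fun k =>
      hS.preimage (continuous_coordinate P k)
  · exact or_congr_right forall_and

variable {F S} in
theorem isDynamicalSystem_shiftPlusStar [CompactSpace X] [TopologicalSpace.MetrizableSpace X]
    (hF : IsClosed F) (hS : IsClosed S) {c : X} (hc : c ∈ S) (hcF : (c, c) ∈ F) :
    IsDynamicalSystem (shiftPlusStar F S) := by
  have : CompactSpace (MahavierPlus F) := compactSpace_constrained F _ hF
  exact ⟨inferInstance, metrizableSpace_glue _ hS hc fun _ => hcF, continuous_shiftPlusStar F S⟩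

variable {F S} in
theorem isDynamicalSystem_shiftTwoStar [CompactSpace X] [TopologicalSpace.MetrizableSpace X]
    (hF : IsClosed F) (hS : IsClosed S) {c : X} (hc : c ∈ S) (hcF : (c, c) ∈ F) :
    IsDynamicalSystem (shiftTwoStar F S) := by
  have : CompactSpace (MahavierTwo F) := compactSpace_constrained F _ hF
  exact ⟨inferInstance, metrizableSpace_glue _ hS hc fun _ => hcF, continuous_shiftTwoStar F S⟩

theorem TopologicallyMixing.shiftPlusStar (h : TopologicallyMixing (shiftPlus F)) :
    TopologicallyMixing (shiftPlusStar F S) :=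
  h.of_semiconj continuous_quotient_mk' Quotient.mk_surjective fun _ => rfl

theorem TopologicallyMixing.shiftTwoStar (h : TopologicallyMixing (shiftTwo F)) :
    TopologicallyMixing (shiftTwoStar F S) :=
  h.of_semiconj continuous_quotient_mk' Quotient.mk_surjective fun _ => rfl

/-! ### From one-sided to two-sided mixing -/

omit [TopologicalSpace X] in
theorem iterate_shiftPlus_apply {F : Set (X × X)} (n : ℕ) (x : MahavierPlus F) (i : ℕ) :
    ((shiftPlus F)^[n] x).1 i = x.1 (i + n) := by
  induction n generalizing x with
  | zero => rfl
  | succ n ih => rw [Function.iterate_succ_apply, ih]; exact congrArg x.1 (by ring)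

omit [TopologicalSpace X] in
theorem iterate_shiftTwo_apply {F : Set (X × X)} (n : ℕ) (x : MahavierTwo F) (i : ℤ) :
    ((shiftTwo F)^[n] x).1 i = x.1 (i + n) := by
  induction n generalizing x with
  | zero => simp
  | succ n ih =>
    rw [Function.iterate_succ_apply, ih]; exact congrArg x.1 (by push_cast; ring)

/-- An open set around a two-sided sequence contains a cylinder over a symmetric window. -/
theorem exists_int_window {U : Set (MahavierTwo F)} (hU : IsOpen U) {x : MahavierTwo F}
    (hx : x ∈ U) : ∃ (m : ℕ) (O : ℤ → Set X), (∀ i, IsOpen (O i) ∧ x.1 i ∈ O i) ∧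
      ∀ y : MahavierTwo F, (∀ i, -(m : ℤ) ≤ i → i ≤ m → y.1 i ∈ O i) → y ∈ U := by
  obtain ⟨W, hW, rfl⟩ := isOpen_induced_iff.1 hU
  obtain ⟨I, u, hu, hIW⟩ := isOpen_pi_iff.1 hW x.1 hx
  refine ⟨I.sup Int.natAbs, fun i => if i ∈ I then u i else univ, fun i => ?_, fun y hy => ?_⟩
  · beta_reduce
    split_ifs with hi
    · exact hu i hi
    · simp
  · refine hIW fun i hi => ?_
    have hle : i.natAbs ≤ I.sup Int.natAbs := Finset.le_sup (f := Int.natAbs) hi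
    simpa [Finset.mem_coe.1 hi] using hy i (by omega) (by omega)

theorem isOpen_initial_window (m : ℕ) {O : ℕ → Set X} (hO : ∀ i, IsOpen (O i)) :
    IsOpen {z : MahavierPlus F | ∀ i ≤ m, z.1 i ∈ O i} := by
  simp only [ofPred_forall]
  exact (finite_Iic m).isOpen_biInter fun i _ =>
    (hO i).preimage (continuous_coordinate _ i)

variable {F} in
/-- If `F` is reflexive, a one-sided sequence extends to the left by a constant; hence the mixing
property passes from the one-sided to the two-sided shift. -/
theorem TopologicallyMixing.shiftTwo_of_shiftPlus (hrefl : ∀ x, (x, x) ∈ F)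
    (h : TopologicallyMixing (shiftPlus F)) : TopologicallyMixing (shiftTwo F) := by
  rintro U V hU hV ⟨x, hx⟩ ⟨y, hy⟩
  obtain ⟨m, O, hO, hOU⟩ := exists_int_window F hU hx
  obtain ⟨l, Q, hQ, hQV⟩ := exists_int_window F hV hy
  have key : ∀ (w : MahavierTwo F) (k : ℕ),
      ∃ w' : MahavierPlus F, ∀ i : ℕ, w'.1 i = w.1 (i - k) := fun w k =>
    ⟨⟨fun i => w.1 (i - k), fun i => by
      have := w.2 (i - k)
      rwa [show (i : ℤ) - k + 1 = ((i + 1 : ℕ) : ℤ) - k by push_cast; ring] at this⟩, fun _ => rfl⟩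
  obtain ⟨x', hx'⟩ := key x m
  obtain ⟨y', hy'⟩ := key y l
  obtain ⟨N, hN⟩ := h {z | ∀ i ≤ 2 * m, z.1 i ∈ O (i - m)} {z | ∀ i ≤ 2 * l, z.1 i ∈ Q (i - l)}
    (isOpen_initial_window F _ fun i => (hO _).1) (isOpen_initial_window F _ fun i => (hQ _).1)
    ⟨x', fun i _ => by rw [hx']; exact (hO _).2⟩ ⟨y', fun i _ => by rw [hy']; exact (hQ _).2⟩
  refine ⟨N + m + l + 1, fun n _ hn => ?_⟩
  -- The windows `[-m, m]` and `[n - l, n + l]` of a two-sided sequence are the windows `[0, 2m]`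
  -- and `[n + m - l, n + m + l]` of its one-sided restriction to `[-m, ∞)`.
  obtain ⟨_, ⟨z, hzU, rfl⟩, hzV⟩ := hN (n + m - l) (by omega) (by omega)
  let w : MahavierTwo F := ⟨fun i => z.1 (i + m).toNat, fun i => by
    rcases lt_or_ge (i + m) 0 with hi | hi
    · beta_reduce
      rw [show (i + 1 + m).toNat = (i + m).toNat by omega]
      exact hrefl _
    · beta_reduce
      rw [show (i + 1 + m).toNat = (i + m).toNat + 1 by omega]
      exact z.2 _⟩
  refine ⟨_, ⟨w, hOU w fun i h1 h2 => ?_, rfl⟩, hQV _ fun i h1 h2 => ?_⟩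
  · have := hzU (i + m).toNat (by omega)
    rwa [show (((i + m).toNat : ℕ) : ℤ) - m = i by omega] at this
  · rw [iterate_shiftTwo_apply]
    have := hzV (i + l).toNat (by omega)
    rw [iterate_shiftPlus_apply] at this
    change z.1 (i + n + m).toNat ∈ Q i
    rwa [show (((i + l).toNat : ℕ) : ℤ) - l = i by omega,
      show (i + l).toNat + (n + m - l) = (i + n + m).toNat by omega] at this

end Quotient

/-! ### The topology of `𝕏` and closedness of `H` -/

theorem isClosed_range_even : IsClosed (range fun n : ℕ => (2 * n : ℝ)) :=
  ((Homeomorph.mulLeft₀ (2 : ℝ) two_ne_zero).isClosedEmbedding.comp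
    Nat.isClosedEmbedding_coe_real).isClosed_range

theorem isClosed_base : IsClosed {t : ℝ | ∃ k : ℕ, t ∈ Icc (2 * k : ℝ) (2 * k + 1)} := by
  convert isClosed_range_even.add_right_of_isCompact (isCompact_Icc (a := (0 : ℝ)) (b := 1)) using 1
  ext t
  simp only [mem_ofPred_eq, Set.mem_add, exists_range_iff, mem_Icc]
  constructor
  · rintro ⟨k, h1, h2⟩
    exact ⟨k, t - 2 * k, ⟨by linarith, by linarith⟩, by ring⟩
  · rintro ⟨k, s, ⟨h1, h2⟩, rfl⟩
    exact ⟨k, by linarith, by linarith⟩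

theorem isClosedEmbedding_base : IsClosedEmbedding (Subtype.val : Base → ℝ) :=
  isClosed_base.isClosedEmbedding_subtypeVal

theorem Base.nonneg (t : Base) : 0 ≤ t.1 := by
  obtain ⟨k, hk, _⟩ := t.2
  exact le_trans (by positivity) hk

/-- The coordinate `t ↦ 1 / (t + 1)`, `∞ ↦ 0`, embedding `𝕏` into the real line. -/
noncomputable def invCoord (p : XX) : ℝ := p.elim 0 fun t => (t.1 + 1)⁻¹

@[simp] theorem invCoord_infty : invCoord OnePoint.infty = 0 := rfl

@[simp] theorem invCoord_coe (t : Base) : invCoord t = (t.1 + 1)⁻¹ := rfl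

theorem continuous_invCoord : Continuous invCoord := by
  refine (OnePoint.continuous_iff _).2 ⟨?_, ?_⟩
  · rw [coclosedCompact_eq_cocompact]
    have h1 : Tendsto (fun t : Base => t.1 + 1) (cocompact Base) atTop := by
      refine tendsto_atTop_add_const_right _ _ ?_
      refine ((tendsto_norm_cocompact_atTop (E := ℝ)).comp
        isClosedEmbedding_base.tendsto_cocompact).congr fun t => ?_
      exact Real.norm_of_nonneg t.nonneg
    exact h1.inv_tendsto_atTop
  · refine Continuous.inv₀ (by fun_prop) fun t : Base => ?_
    have := t.nonneg
    positivity

theorem injective_invCoord : Function.Injective invCoord := by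
  intro p q h
  induction p using OnePoint.rec with
  | infty =>
    induction q using OnePoint.rec with
    | infty => rfl
    | coe t =>
      have : 0 < (t.1 + 1)⁻¹ := by have := t.nonneg; positivity
      exact absurd h this.ne
  | coe s =>
    induction q using OnePoint.rec with
    | infty =>
      have : 0 < (s.1 + 1)⁻¹ := by have := s.nonneg; positivity
      exact absurd h this.ne'
    | coe t =>
      rw [invCoord_coe, invCoord_coe, inv_inj, add_left_inj] at h
      rw [Subtype.ext h]

theorem isClosedEmbedding_invCoord : IsClosedEmbedding invCoord :=
  continuous_invCoord.isClosedEmbedding injective_invCoord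

instance : TopologicalSpace.MetrizableSpace XX :=
  isClosedEmbedding_invCoord.isEmbedding.metrizableSpace

theorem isClosed_evenPtsInfty : IsClosed evenPtsInfty := by
  rw [OnePoint.isClosed_iff_of_mem (Or.inr rfl)]
  convert isClosed_range_even.preimage continuous_subtype_val using 1
  ext t
  constructor
  · rintro (⟨s, ⟨i, hi⟩, hs⟩ | h)
    · rw [OnePoint.coe_eq_coe] at hs
      subst hs
      exact ⟨i, hi.symm⟩
    · exact absurd h (OnePoint.coe_ne_infty t)
  · rintro ⟨i, hi⟩
    exact Or.inl ⟨t, ⟨i, hi.symm⟩, rfl⟩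

theorem coe_mem_lineRel_iff {c : ℝ} {s t : Base} :
    ((s : XX), (t : XX)) ∈ lineRel c ↔ s.1 ≤ 1 ∧ t.1 ≤ 1 ∧ t.1 = c * s.1 := by
  constructor
  · rintro ⟨s', t', hs, ht, h, heq⟩
    obtain ⟨h1, h2⟩ := Prod.mk.inj heq
    obtain rfl := OnePoint.coe_injective h1
    obtain rfl := OnePoint.coe_injective h2
    exact ⟨hs.2, ht.2, h⟩
  · rintro ⟨hs, ht, h⟩
    exact ⟨s, t, ⟨s.nonneg, hs⟩, ⟨t.nonneg, ht⟩, h, rfl⟩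

theorem coe_mem_H_iff {r ρ : ℝ} {s t : Base} :
    ((s : XX), (t : XX)) ∈ H r ρ ↔ (s.1 ≤ 1 ∧ t.1 ≤ 1 ∧ (t.1 = r * s.1 ∨ t.1 = ρ * s.1)) ∨
      t.1 = s.1 + 2 ∨ s.1 = t.1 + 2 ∨ t = s := by
  have h3 : ((s : XX), (t : XX)) ∈
      {p : XX × XX | ∃ s t : Base, t.1 = s.1 + 2 ∧ p = ((s : XX), (t : XX))} ↔
      t.1 = s.1 + 2 := by
    refine ⟨?_, fun h => ⟨s, t, h, rfl⟩⟩
    rintro ⟨s', t', h, heq⟩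
    obtain ⟨h1, h2⟩ := Prod.mk.inj heq
    rwa [OnePoint.coe_injective h1, OnePoint.coe_injective h2]
  have h4 : ((s : XX), (t : XX)) ∈
      {p : XX × XX | ∃ s t : Base, 2 ≤ s.1 ∧ t.1 = s.1 - 2 ∧ p = ((s : XX), (t : XX))} ↔
      s.1 = t.1 + 2 := by
    refine ⟨?_, fun h => ⟨s, t, by linarith [t.nonneg], by linarith, rfl⟩⟩
    rintro ⟨s', t', _, h, heq⟩
    obtain ⟨h1, h2⟩ := Prod.mk.inj heq
    rw [OnePoint.coe_injective h1, OnePoint.coe_injective h2]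
    linarith
  have h5 : ((s : XX), (t : XX)) ∈ {p : XX × XX | ∃ s : Base, p = ((s : XX), (s : XX))} ↔
      t = s := by
    refine ⟨?_, fun h => ⟨s, by rw [h]⟩⟩
    rintro ⟨s', heq⟩
    obtain ⟨h1, h2⟩ := Prod.mk.inj heq
    rw [OnePoint.coe_injective h1, OnePoint.coe_injective h2]
  have h6 : ((s : XX), (t : XX)) ∉ ({(OnePoint.infty, OnePoint.infty)} : Set (XX × XX)) :=
    fun h => OnePoint.coe_ne_infty s (Prod.mk.inj h).1
  rw [H, mem_union, mem_union, mem_union, mem_union, mem_union, h3, h4, h5,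
    coe_mem_lineRel_iff, coe_mem_lineRel_iff]
  tauto

theorem diag_mem_H (r ρ : ℝ) (p : XX) : (p, p) ∈ H r ρ := by
  induction p using OnePoint.rec with
  | infty => exact Or.inr rfl
  | coe s => exact Or.inl (Or.inr ⟨s, rfl⟩)

theorem eq_infty_iff_of_mem_H {r ρ : ℝ} {p q : XX} (h : (p, q) ∈ H r ρ) :
    p = OnePoint.infty ↔ q = OnePoint.infty := by
  rcases h with (((((⟨s, t, -, -, -, h⟩ | ⟨s, t, -, -, -, h⟩) | ⟨s, t, -, h⟩) |
    ⟨s, t, -, -, h⟩) | ⟨s, h⟩) | h) <;> obtain ⟨rfl, rfl⟩ := Prod.mk.inj h <;> simp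

theorem isClosed_H (r ρ : ℝ) : IsClosed (H r ρ) := by
  have c1 : Continuous fun p : XX × XX => invCoord p.1 := continuous_invCoord.comp continuous_fst
  have c2 : Continuous fun p : XX × XX => invCoord p.2 := continuous_invCoord.comp continuous_snd
  have heq : H r ρ = {p | 1 / 2 ≤ invCoord p.1 ∧ 1 / 2 ≤ invCoord p.2 ∧
        (invCoord p.1 * (1 - invCoord p.2) = r * (invCoord p.2 * (1 - invCoord p.1)) ∨
          invCoord p.1 * (1 - invCoord p.2) = ρ * (invCoord p.2 * (1 - invCoord p.1)))} ∪
      {p | invCoord p.1 = invCoord p.2 * (1 + 2 * invCoord p.1)} ∪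
      {p | invCoord p.2 = invCoord p.1 * (1 + 2 * invCoord p.2)} ∪ {p | p.2 = p.1} := by
    ext ⟨p, q⟩
    by_cases hp : p = OnePoint.infty <;> by_cases hq : q = OnePoint.infty
    · subst hp hq
      exact iff_of_true (diag_mem_H _ _ _) (Or.inr rfl)
    · refine iff_of_false (fun h => hq ((eq_infty_iff_of_mem_H h).1 hp)) ?_
      have := injective_invCoord.ne hq
      subst hp
      simp only [mem_union, mem_ofPred_eq, invCoord_infty] at this ⊢
      norm_num
      tauto
    · refine iff_of_false (fun h => hp ((eq_infty_iff_of_mem_H h).2 hq)) ?_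
      have := injective_invCoord.ne hp
      subst hq
      simp only [mem_union, mem_ofPred_eq, invCoord_infty] at this ⊢
      norm_num
      tauto
    · obtain ⟨s, rfl⟩ := OnePoint.ne_infty_iff_exists.1 hp
      obtain ⟨t, rfl⟩ := OnePoint.ne_infty_iff_exists.1 hq
      have hs : 0 < s.1 + 1 := by linarith [s.nonneg]
      have ht : 0 < t.1 + 1 := by linarith [t.nonneg]
      have half : ∀ x : ℝ, 0 < x + 1 → (1 / 2 ≤ (x + 1)⁻¹ ↔ x ≤ 1) := fun x hx => by
        rw [one_div, inv_le_inv₀ two_pos hx]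
        constructor <;> intro <;> linarith
      have slope : ∀ c : ℝ, (s.1 + 1)⁻¹ * (1 - (t.1 + 1)⁻¹) =
          c * ((t.1 + 1)⁻¹ * (1 - (s.1 + 1)⁻¹)) ↔ t.1 = c * s.1 := fun c => by
        field_simp
        simp [mul_comm]
      have up : ∀ x y : ℝ, 0 < x + 1 → 0 < y + 1 →
          ((x + 1)⁻¹ = (y + 1)⁻¹ * (1 + 2 * (x + 1)⁻¹) ↔ y = x + 2) := fun x y hx hy => by
        field_simp
        constructor <;> intro <;> linarith
      simp only [coe_mem_H_iff, mem_union, mem_ofPred_eq, invCoord_coe, half _ hs, half _ ht, slope,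
        up _ _ hs ht, up _ _ ht hs, OnePoint.coe_eq_coe, or_assoc]
  rw [heq]
  refine ((IsClosed.union ?_ ?_).union ?_).union ?_
  · refine (isClosed_le continuous_const c1).inter ((isClosed_le continuous_const c2).inter
      ((isClosed_eq ?_ ?_).union (isClosed_eq ?_ ?_))) <;> fun_prop
  · exact isClosed_eq c1 (by fun_prop)
  · exact isClosed_eq c2 (by fun_prop)
  · exact isClosed_eq continuous_snd continuous_fst

/-! ### Levels and heights -/

/-- The point `2 k + s` of `𝕏`, at level `k` and height `s`. -/
noncomputable def pt (k : ℕ) (s : unitInterval) : XX :=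
  ((⟨2 * k + s, k, by linarith [s.2.1], by linarith [s.2.2]⟩ : Base) : XX)

theorem continuous_pt (k : ℕ) : Continuous (pt k) :=
  OnePoint.continuous_coe.comp (Continuous.subtype_mk (by fun_prop) _)

theorem exists_eq_pt {p : XX} (hp : p ≠ OnePoint.infty) : ∃ k s, p = pt k s := by
  obtain ⟨t, rfl⟩ := OnePoint.ne_infty_iff_exists.1 hp
  obtain ⟨k, h1, h2⟩ := t.2
  refine ⟨k, ⟨t - 2 * k, by linarith, by linarith⟩, ?_⟩
  exact congrArg _ (Subtype.ext (by simp))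

theorem level_height_unique {k l : ℕ} {s t : unitInterval} (h : (2 * k + s : ℝ) = 2 * l + t) :
    k = l ∧ s = t := by
  have hs := s.2
  have ht := t.2
  have h1 : k < l + 1 := by
    have : (k : ℝ) < l + 1 := by linarith [hs.1, ht.2]
    exact_mod_cast this
  have h2 : l < k + 1 := by
    have : (l : ℝ) < k + 1 := by linarith [ht.1, hs.2]
    exact_mod_cast this
  obtain rfl : k = l := by omega
  exact ⟨rfl, Subtype.ext (by linarith)⟩

theorem pt_mem_H_iff {r ρ : ℝ} {k l : ℕ} {s t : unitInterval} :
    (pt k s, pt l t) ∈ H r ρ ↔ (k = 0 ∧ l = 0 ∧ ((t : ℝ) = r * s ∨ (t : ℝ) = ρ * s)) ∨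
      ((l = k + 1 ∨ k = l + 1 ∨ l = k) ∧ t = s) := by
  have hs := s.2
  have ht := t.2
  have zero_level : ∀ (k : ℕ) (s : unitInterval), (2 * k + s : ℝ) ≤ 1 → k = 0 := fun k s h => by
    have : (k : ℝ) < 1 := by linarith [s.2.1]
    exact Nat.lt_one_iff.1 (by exact_mod_cast this)
  rw [pt, pt, coe_mem_H_iff, Subtype.ext_iff]
  dsimp only
  constructor
  · rintro (⟨h1, h2, h⟩ | h | h | h)
    · obtain rfl := zero_level k s h1
      obtain rfl := zero_level l t h2
      simp only [CharP.cast_eq_zero, mul_zero, zero_add] at h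
      exact Or.inl ⟨rfl, rfl, h⟩
    · obtain ⟨h1, h2⟩ := level_height_unique (k := l) (l := k + 1) (s := t) (t := s)
        (by push_cast; linarith)
      exact Or.inr ⟨Or.inl h1, h2⟩
    · obtain ⟨h1, h2⟩ := level_height_unique (k := k) (l := l + 1) (s := s) (t := t)
        (by push_cast; linarith)
      exact Or.inr ⟨Or.inr (Or.inl h1), h2.symm⟩
    · obtain ⟨h1, h2⟩ := level_height_unique h
      exact Or.inr ⟨Or.inr (Or.inr h1), h2⟩
  · rintro (⟨rfl, rfl, h⟩ | ⟨rfl | rfl | rfl, rfl⟩)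
    · left
      simpa using ⟨hs.2, ht.2, h⟩
    · right; left; push_cast; ring
    · right; right; left; push_cast; ring
    · exact Or.inr (Or.inr (Or.inr rfl))

theorem tendsto_pt_infty (s : unitInterval) :
    Tendsto (fun k => pt k s) atTop (𝓝 OnePoint.infty) := by
  rw [isClosedEmbedding_invCoord.isEmbedding.tendsto_nhds_iff]
  have : Tendsto (fun k : ℕ => (2 * k + s + 1 : ℝ)) atTop atTop := by
    refine tendsto_atTop_add_const_right _ _ (tendsto_atTop_add_const_right _ _ ?_)
    exact tendsto_natCast_atTop_atTop.const_mul_atTop two_pos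
  exact this.inv_tendsto_atTop

/-! ### Connecting points by finite walks -/

section Walks

variable {X : Type*} {F : Set (X × X)}

/-- `q` is reached from `p` by a walk of exactly `n` steps in the relation `F`; the walk is encoded
as the beginning of an infinite one, which is no restriction when `F` is reflexive. -/
def ReachesIn (F : Set (X × X)) (n : ℕ) (p q : X) : Prop :=
  ∃ z : MahavierPlus F, z.1 0 = p ∧ z.1 n = q

/-- The walk `z` up to time `n`, followed by the walk `w`. -/
theorem exists_splice {n : ℕ} {z w : MahavierPlus F} (h : z.1 n = w.1 0) :
    ∃ v : MahavierPlus F, (∀ i ≤ n, v.1 i = z.1 i) ∧ ∀ i, v.1 (i + n) = w.1 i := by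
  refine ⟨⟨fun i => if i ≤ n then z.1 i else w.1 (i - n), fun i => ?_⟩,
    fun i hi => if_pos hi, fun i => ?_⟩
  · beta_reduce
    rcases lt_trichotomy i n with hi | rfl | hi
    · rw [if_pos hi.le, if_pos (Nat.succ_le_of_lt hi)]
      exact z.2 i
    · rw [if_pos le_rfl, if_neg (Nat.not_succ_le_self i), h, Nat.add_sub_cancel_left]
      exact w.2 0
    · rw [if_neg hi.not_ge, if_neg (Nat.lt_succ_of_lt hi).not_ge, Nat.sub_add_comm hi.le]
      exact w.2 _
  · rcases Nat.eq_zero_or_pos i with rfl | hi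
    · simp [h]
    · dsimp only
      rw [if_neg (show ¬ i + n ≤ n by omega), Nat.add_sub_cancel]

theorem ReachesIn.trans {m n : ℕ} {p q w : X} (h₁ : ReachesIn F m p q) (h₂ : ReachesIn F n q w) :
    ReachesIn F (n + m) p w := by
  obtain ⟨z, rfl, rfl⟩ := h₁
  obtain ⟨z', h, rfl⟩ := h₂
  obtain ⟨v, hv, hv'⟩ := exists_splice h.symm
  exact ⟨v, hv 0 (Nat.zero_le _), hv' n⟩

theorem reachesIn_self (hrefl : ∀ x, (x, x) ∈ F) (n : ℕ) (p : X) : ReachesIn F n p p :=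
  ⟨⟨fun _ => p, fun _ => hrefl p⟩, rfl, rfl⟩

theorem ReachesIn.of_le (hrefl : ∀ x, (x, x) ∈ F) {m n : ℕ} {p q : X} (h : ReachesIn F m p q)
    (hmn : m ≤ n) : ReachesIn F n p q := by
  have := h.trans (reachesIn_self hrefl (n - m) q)
  rwa [Nat.sub_add_cancel hmn] at this

theorem reachesIn_one (hrefl : ∀ x, (x, x) ∈ F) {p q : X} (h : (p, q) ∈ F) :
    ReachesIn F 1 p q :=
  ⟨⟨fun i => if i = 0 then p else q, fun i => by
    rcases Nat.eq_zero_or_pos i with rfl | hi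
    · simpa using h
    · simpa [hi.ne'] using hrefl q⟩, rfl, rfl⟩

end Walks

variable {r ρ : ℝ}

theorem reachesIn_level_down (s : unitInterval) (k : ℕ) :
    ReachesIn (H r ρ) k (pt k s) (pt 0 s) := by
  induction k with
  | zero => exact reachesIn_self (diag_mem_H r ρ) _ _
  | succ k ih =>
    exact (reachesIn_one (diag_mem_H r ρ)
      (pt_mem_H_iff.2 (Or.inr ⟨Or.inr (Or.inl rfl), rfl⟩))).trans ih

theorem reachesIn_level_up (s : unitInterval) (k : ℕ) :
    ReachesIn (H r ρ) k (pt 0 s) (pt k s) := by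
  induction k with
  | zero => exact reachesIn_self (diag_mem_H r ρ) _ _
  | succ k ih =>
    have := ih.trans (reachesIn_one (diag_mem_H r ρ)
      (pt_mem_H_iff.2 (Or.inr ⟨Or.inl rfl, rfl⟩)))
    rwa [add_comm] at this

theorem reachesIn_pow_mul {c : ℝ} (hc : c = r ∨ c = ρ) (hc0 : 0 < c) (a : ℕ) {s t : unitInterval}
    (h : (t : ℝ) = c ^ a * s) : ReachesIn (H r ρ) a (pt 0 s) (pt 0 t) := by
  induction a generalizing t with
  | zero =>
    obtain rfl : t = s := Subtype.ext (by simpa using h)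
    exact reachesIn_self (diag_mem_H r ρ) _ _
  | succ a ih =>
    have hs := s.2
    have ht := t.2
    have h0 : 0 ≤ c ^ a * s := mul_nonneg (by positivity) hs.1
    have hstep : (t : ℝ) = c * (c ^ a * s) := by rw [h]; ring
    -- The heights along the walk are monotone, so they stay below the larger of `s` and `t`.
    have h1 : c ^ a * s ≤ 1 := by
      rcases le_total c 1 with hc1 | hc1
      · exact mul_le_one₀ (pow_le_one₀ hc0.le hc1) hs.1 hs.2
      · exact (le_mul_of_one_le_left h0 hc1).trans (hstep ▸ ht.2)
    rw [add_comm]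
    refine (ih (t := ⟨c ^ a * s, h0, h1⟩) rfl).trans (reachesIn_one (diag_mem_H r ρ) ?_)
    refine pt_mem_H_iff.2 (Or.inl ⟨rfl, rfl, ?_⟩)
    rcases hc with rfl | rfl
    · exact Or.inl hstep
    · exact Or.inr hstep

/-- A point of height `s` is joined to a point of height `r ^ a * ρ ^ b * s`, whatever the levels:
descend to level `0`, rescale there, and climb. -/
theorem reachesIn_pt (h : NeverConnect r ρ) (a b k l : ℕ) {s t : unitInterval}
    (hst : (t : ℝ) = r ^ a * ρ ^ b * s) : ∃ N, ReachesIn (H r ρ) N (pt k s) (pt l t) := by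
  have hs := s.2
  have hr := h.pos_left
  -- The contracting steps come first, so that all heights stay in `[0, 1]`.
  let u : unitInterval := ⟨r ^ a * s, mul_nonneg (by positivity) hs.1,
    mul_le_one₀ (pow_le_one₀ hr.le h.left_lt_one.le) hs.1 hs.2⟩
  have h1 := reachesIn_pow_mul (r := r) (ρ := ρ) (Or.inl rfl) hr a (s := s) (t := u) rfl
  have h2 := reachesIn_pow_mul (r := r) (ρ := ρ) (Or.inr rfl) h.pos_right b (s := u) (t := t)
    (by rw [hst]; simp only [u]; ring)
  exact ⟨_, (((reachesIn_level_down s k).trans h1).trans h2).trans (reachesIn_level_up t l)⟩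

/-! ### Sequences of positive height -/

theorem exists_levels_heights {x : MahavierPlus (H r ρ)} (h : x.1 0 ≠ OnePoint.infty) :
    ∃ (k : ℕ → ℕ) (s : ℕ → unitInterval), ∀ i, x.1 i = pt (k i) (s i) := by
  have hne : ∀ i, x.1 i ≠ OnePoint.infty := by
    intro i
    induction i with
    | zero => exact h
    | succ i ih => exact fun hi => ih ((eq_infty_iff_of_mem_H (x.2 i)).2 hi)
  choose k s hks using fun i => exists_eq_pt (hne i)
  exact ⟨k, s, hks⟩

theorem height_pos_iff (h : NeverConnect r ρ) {k l : ℕ} {s t : unitInterval}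
    (hst : (pt k s, pt l t) ∈ H r ρ) : (0 : ℝ) < s ↔ (0 : ℝ) < t := by
  rcases pt_mem_H_iff.1 hst with ⟨-, -, h' | h'⟩ | ⟨-, rfl⟩
  · rw [h', mul_pos_iff_of_pos_left h.pos_left]
  · rw [h', mul_pos_iff_of_pos_left h.pos_right]
  · rfl

theorem height_pos_iff_zero (h : NeverConnect r ρ) {x : MahavierPlus (H r ρ)} {k : ℕ → ℕ}
    {s : ℕ → unitInterval} (hx : ∀ i, x.1 i = pt (k i) (s i)) (i : ℕ) :
    (0 : ℝ) < s i ↔ (0 : ℝ) < s 0 := by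
  induction i with
  | zero => rfl
  | succ i ih =>
    have := x.2 i
    rw [hx, hx] at this
    exact (height_pos_iff h this).symm.trans ih

theorem pt_mul_mem_H {k l : ℕ} {s t : unitInterval} (c : unitInterval)
    (hst : (pt k s, pt l t) ∈ H r ρ) : (pt k (c * s), pt l (c * t)) ∈ H r ρ := by
  rcases pt_mem_H_iff.1 hst with ⟨hk, hl, h' | h'⟩ | ⟨hkl, rfl⟩
  · exact pt_mem_H_iff.2 (Or.inl ⟨hk, hl, Or.inl (by push_cast; rw [h']; ring)⟩)
  · exact pt_mem_H_iff.2 (Or.inl ⟨hk, hl, Or.inr (by push_cast; rw [h']; ring)⟩)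
  · exact pt_mem_H_iff.2 (Or.inr ⟨hkl, rfl⟩)

/-- The sequences with all heights positive are dense. -/
theorem exists_pos_height_mem (h : NeverConnect r ρ) {U : Set (MahavierPlus (H r ρ))}
    (hU : IsOpen U) (hne : U.Nonempty) : ∃ x ∈ U, ∃ (k : ℕ → ℕ) (s : ℕ → unitInterval),
      (∀ i, x.1 i = pt (k i) (s i)) ∧ ∀ i, (0 : ℝ) < s i := by
  obtain ⟨x, hx⟩ := hne
  by_cases hinf : x.1 0 = OnePoint.infty
  · -- `x` is the constant sequence `∞`, the limit of the constant sequences `2 n + 1`.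
    have hxi : ∀ i, x.1 i = OnePoint.infty := by
      intro i
      induction i with
      | zero => exact hinf
      | succ i ih => exact (eq_infty_iff_of_mem_H (x.2 i)).1 ih
    have hlim : Tendsto (fun n => (⟨fun _ => pt n 1, fun _ => diag_mem_H r ρ _⟩ :
        MahavierPlus (H r ρ))) atTop (𝓝 x) := by
      rw [tendsto_subtype_rng, tendsto_pi_nhds]
      intro i
      rw [hxi i]
      exact tendsto_pt_infty 1
    obtain ⟨n, hn⟩ := (hlim.eventually (hU.mem_nhds hx)).exists
    exact ⟨_, hn, fun _ => n, fun _ => 1, fun _ => rfl, fun _ => by simp⟩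
  obtain ⟨k, s, hks⟩ := exists_levels_heights hinf
  by_cases hpos : (0 : ℝ) < s 0
  · exact ⟨x, hx, k, s, hks, fun i => (height_pos_iff_zero h hks i).2 hpos⟩
  -- All heights are `0`; raising all of them by the same amount gives a sequence near `x`.
  have hs0 : ∀ i, s i = 0 := fun i => Subtype.ext <| le_antisymm
    (not_lt.1 fun hi => hpos ((height_pos_iff_zero h hks i).1 hi)) (s i).2.1
  simp only [hs0] at hks
  have hstep : ∀ i, k (i + 1) = k i + 1 ∨ k i = k (i + 1) + 1 ∨ k (i + 1) = k i := by
    intro i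
    have := x.2 i
    rw [hks, hks, pt_mem_H_iff] at this
    omega
  let y : unitInterval → MahavierPlus (H r ρ) := fun t =>
    ⟨fun i => pt (k i) t, fun i => pt_mem_H_iff.2 (Or.inr ⟨hstep i, rfl⟩)⟩
  have hy : Continuous y := (continuous_pi fun i => continuous_pt (k i)).subtype_mk _
  have hy0 : y 0 = x := Subtype.ext (funext fun i => (hks i).symm)
  have hev : ∀ᶠ t in 𝓝[>] (0 : unitInterval), y t ∈ U :=
    (hy.tendsto 0).mono_left nhdsWithin_le_nhds (hU.mem_nhds (hy0 ▸ hx))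
  have : (𝓝[>] (0 : unitInterval)).NeBot := nhdsGT_neBot_of_exists_gt ⟨1, zero_lt_one⟩
  obtain ⟨t, ht, ht0⟩ := (hev.and self_mem_nhdsWithin).exists
  exact ⟨y t, ht, k, fun _ => t, fun _ => rfl, fun _ => ht0⟩

/-- Scaling all heights by a factor below and close enough to `1` keeps a sequence inside an open
set. -/
theorem exists_scaled_mem {V : Set (MahavierPlus (H r ρ))} (hV : IsOpen V)
    {y : MahavierPlus (H r ρ)} (hy : y ∈ V) {k : ℕ → ℕ} {s : ℕ → unitInterval}
    (hks : ∀ i, y.1 i = pt (k i) (s i)) : ∃ μ : ℝ, 0 < μ ∧ μ < 1 ∧ ∀ c : unitInterval, μ < c →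
      ∃ w ∈ V, ∀ i, w.1 i = pt (k i) (c * s i) := by
  let w : unitInterval → MahavierPlus (H r ρ) := fun c =>
    ⟨fun i => pt (k i) (c * s i), fun i => pt_mul_mem_H c (by rw [← hks, ← hks]; exact y.2 i)⟩
  have hw : Continuous w := (continuous_pi fun i =>
    (continuous_pt (k i)).comp (continuous_id.mul continuous_const)).subtype_mk _
  have hw1 : w 1 = y := Subtype.ext (funext fun i => by simp [w, hks])
  obtain ⟨ε, hε, hball⟩ := Metric.isOpen_iff.1 (hV.preimage hw) 1 (by simpa [hw1] using hy)
  refine ⟨max (1 / 2) (1 - ε), by positivity, by norm_num [hε], fun c hc => ⟨w c, hball ?_,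
    fun _ => rfl⟩⟩
  have := (max_lt_iff.1 hc).2
  rw [Metric.mem_ball, Subtype.dist_eq, Real.dist_eq, abs_lt]
  constructor <;> norm_num <;> linarith [c.2.2]

/-! ### Mixing -/

/-- An open set around a one-sided sequence contains all sequences that agree with it long
enough. -/
theorem exists_nat_window {X : Type*} [TopologicalSpace X] {F : Set (X × X)}
    {U : Set (MahavierPlus F)} (hU : IsOpen U) {x : MahavierPlus F} (hx : x ∈ U) :
    ∃ m : ℕ, ∀ y : MahavierPlus F, (∀ i ≤ m, y.1 i = x.1 i) → y ∈ U := by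
  obtain ⟨W, hW, rfl⟩ := isOpen_induced_iff.1 hU
  obtain ⟨I, u, hu, hIW⟩ := isOpen_pi_iff.1 hW x.1 hx
  refine ⟨I.sup id, fun y hy => hIW fun i hi => ?_⟩
  rw [hy i (Finset.le_sup (f := id) hi)]
  exact (hu i hi).2

/-- The shift on the Mahavier product of `H` is mixing, already before gluing. -/
theorem topologicallyMixing_shiftPlus (h : NeverConnect r ρ) :
    TopologicallyMixing (shiftPlus (H r ρ)) := by
  intro U V hU hV hUne hVne
  obtain ⟨x, hxU, k, s, hx, hs⟩ := exists_pos_height_mem h hU hUne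
  obtain ⟨y, hyV, l, t, hy, ht⟩ := exists_pos_height_mem h hV hVne
  obtain ⟨m, hm⟩ := exists_nat_window hU hxU
  obtain ⟨μ, hμ0, hμ1, hμ⟩ := exists_scaled_mem hV hyV hy
  have hsm := hs m
  have ht0 := ht 0
  -- The height `s m` is carried by `r ^ a * ρ ^ b` to `c * t 0` with `c` in `(μ, 1)`.
  obtain ⟨a, b, hab⟩ := h.exists_pow_mul_pow_mem_Ioo (x := μ * t 0 / s m) (y := t 0 / s m)
    (by positivity) (by gcongr; exact mul_lt_of_lt_one_left ht0 hμ1)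
  rw [mem_Ioo, div_lt_iff₀ hsm, lt_div_iff₀ hsm] at hab
  have hc1 : μ < r ^ a * ρ ^ b * s m / t 0 := (lt_div_iff₀ ht0).2 hab.1
  let c : unitInterval := ⟨r ^ a * ρ ^ b * s m / t 0, (hμ0.trans hc1).le,
    (div_le_one ht0).2 hab.2.le⟩
  obtain ⟨w, hwV, hw⟩ := hμ c hc1
  obtain ⟨N, hN⟩ := reachesIn_pt h a b (k m) (l 0) (s := s m) (t := c * t 0)
    (by push_cast; exact div_mul_cancel₀ _ ht0.ne')
  refine ⟨N + m, fun n _ hn => ?_⟩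
  obtain ⟨z, hz0, hzn⟩ := hN.of_le (diag_mem_H r ρ) (show N ≤ n - m by omega)
  obtain ⟨v, hv, hv'⟩ := exists_splice (z := z) (w := w) (n := n - m) (by rw [hzn, hw])
  obtain ⟨q, hq, hq'⟩ := exists_splice (z := x) (w := v) (n := m)
    (by rw [hv 0 (Nat.zero_le _), hz0, hx])
  refine ⟨w, ⟨q, hm q hq, Subtype.ext (funext fun i => ?_)⟩, hwV⟩
  rw [iterate_shiftPlus_apply, show i + n = i + (n - m) + m by omega, hq', hv']

/-! ### Failure of injectivity -/

theorem pt_one_notMem_evenPtsInfty (k : ℕ) : pt k 1 ∉ evenPtsInfty := by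
  rintro (⟨s, ⟨i, hi⟩, hs⟩ | h)
  · rw [pt, OnePoint.coe_eq_coe] at hs
    subst hs
    have h1 : (2 * k + 1 : ℝ) = 2 * i := hi
    have h2 : 2 * k + 1 = 2 * i := by exact_mod_cast h1
    omega
  · exact OnePoint.coe_ne_infty _ h

theorem not_bijective_shiftPlusStar {S : Set XX} (hS : S ⊆ evenPtsInfty) :
    ¬ Function.Bijective (shiftPlusStar (H r ρ) S) := by
  intro hbij
  -- The sequences `1, 1, 1, …` and `3, 1, 1, …` have the same shift.
  let x : MahavierPlus (H r ρ) := ⟨fun _ => pt 0 1, fun _ => diag_mem_H r ρ _⟩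
  obtain ⟨y, hy0, hy⟩ := exists_splice (F := H r ρ) (n := 1) (w := x)
    (z := ⟨fun i => if i = 0 then pt 1 1 else pt 0 1, fun i => by
      rcases Nat.eq_zero_or_pos i with rfl | hi
      · exact pt_mem_H_iff.2 (Or.inr ⟨Or.inr (Or.inl rfl), rfl⟩)
      · simpa [hi.ne'] using diag_mem_H r ρ _⟩) rfl
  have hxy : shiftPlus (H r ρ) y = shiftPlus (H r ρ) x :=
    Subtype.ext (funext fun i => hy i)
  have heq := hbij.1 (a₁ := Quotient.mk _ y) (a₂ := Quotient.mk _ x) (congrArg (Quotient.mk _) hxy)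
  rcases Quotient.exact heq with h | h
  · have h0 : y.1 0 = x.1 0 := by rw [h]
    rw [hy0 0 zero_le_one] at h0
    have h1 := OnePoint.coe_injective (h0 : pt 1 1 = pt 0 1)
    have h2 := congrArg Subtype.val h1
    norm_num at h2
  · exact pt_one_notMem_evenPtsInfty 0 (hS (h 0).2)

end LelekMixing

theorem mainTheorem8 (r ρ : ℝ) (h : NeverConnect r ρ) :
    -- gluing the sequences with all coordinates in `{0, 2, 4, …} ∪ {∞}`
    ((IsDynamicalSystem (shiftPlusStar (H r ρ) evenPtsInfty) ∧
        ¬ Function.Bijective (shiftPlusStar (H r ρ) evenPtsInfty) ∧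
        TopologicallyMixing (shiftPlusStar (H r ρ) evenPtsInfty)) ∧
      (IsDynamicalSystem (shiftTwoStar (H r ρ) evenPtsInfty) ∧
        IsHomeomorph (shiftTwoStar (H r ρ) evenPtsInfty) ∧
        TopologicallyMixing (shiftTwoStar (H r ρ) evenPtsInfty))) ∧
    -- gluing only the sequences with all coordinates in `{0, 2, 4, …}`
    ((Continuous (shiftPlusStar (H r ρ) evenPts) ∧
        ¬ Function.Bijective (shiftPlusStar (H r ρ) evenPts) ∧
        TopologicallyMixing (shiftPlusStar (H r ρ) evenPts)) ∧
      (IsHomeomorph (shiftTwoStar (H r ρ) evenPts) ∧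
        TopologicallyMixing (shiftTwoStar (H r ρ) evenPts))) := by
  have hmix := topologicallyMixing_shiftPlus h
  have hmix2 := hmix.shiftTwo_of_shiftPlus (diag_mem_H r ρ)
  have hinf : OnePoint.infty ∈ evenPtsInfty := Or.inr rfl
  refine ⟨⟨⟨?_, ?_, ?_⟩, ?_, ?_, ?_⟩, ⟨?_, ?_, ?_⟩, ?_, ?_⟩
  · exact isDynamicalSystem_shiftPlusStar (isClosed_H r ρ) isClosed_evenPtsInfty hinf
      (diag_mem_H r ρ _)
  · exact not_bijective_shiftPlusStar Subset.rfl
  · exact TopologicallyMixing.shiftPlusStar _ _ hmix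
  · exact isDynamicalSystem_shiftTwoStar (isClosed_H r ρ) isClosed_evenPtsInfty hinf
      (diag_mem_H r ρ _)
  · exact isHomeomorph_shiftTwoStar _ _
  · exact TopologicallyMixing.shiftTwoStar _ _ hmix2
  · exact continuous_shiftPlusStar _ _
  · exact not_bijective_shiftPlusStar subset_union_left
  · exact TopologicallyMixing.shiftPlusStar _ _ hmix
  · exact isHomeomorph_shiftTwoStar _ _
  · exact TopologicallyMixing.shiftTwoStar _ _ hmix2
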